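/- Fix $n\ge 1$ and a set $\Omega$ of random seeds. An *online algorithm* $\mathcal A\in\mathsf{ONLINE}(n)$ takes as input two graphs $G_1,G_2$ with vertex set $[n]$ and a seed $\omega\in\Omega$, starts from $P_j^{(0)}=S_j^{(0)}=\emptyset$ ($j=1,2$), and in each round $t=1,\dots,n$ does the following. 1. Based on $\omega$ and the information $P_j^{(t-1)},\,G_j[P_j^{(t-1)}],\,S_j^{(t-1)}$ ($j=1,2$), it selects vertices $v_j^{(t)}\in[n]\setminus P_j^{(t-1)}$ and sets $P_j^{(t)}=P_j^{(t-1)}\cup\{v_j^{(t)}\}$ for $j=1,2$; the induced subgraphs $G_j[P_j^{(t)}]$ are revealed. 2. Based on $\omega$ and all information revealed so far, it either keeps $(S_1^{(t)},S_2^{(t)})=(S_1^{(t-1)},S_2^{(t-1)})$ or sets $(S_1^{(t)},S_2^{(t)})=(S_1^{(t-1)}\cup\{v_1\},S_2^{(t-1)}\cup\{v_2\})$ for some $v_1\in P_1^{(t)}$, $v_2\in P_2^{(t)}$ with $v_1=v_1^{(t)}$ or $v_2=v_2^{(t)}$ (or both). This must be done so that $G_1[S_1^{(t)}]\cong G_2[S_2^{(t)}]$,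 for every input and every seed. The decision rules are otherwise arbitrary functions. The output is $(G_1[S_1^{(n)}],G_2[S_2^{(n)}])$, and its size is $|\mathcal A(G_1,G_2,\omega)|:=|S_1^{(n)}|=|S_2^{(n)}|$. **Theorem.** For every $\varepsilon>0$ there exist $c>0$ and $N\in\mathbb N$, depending only on $\varepsilon$, such that for all $n\ge N$, every seed set $\Omega$, every $\mathcal A\in\mathsf{ONLINE}(n)$ and every $\omega\in\Omega$, if $G_1,G_2$ are independent Erdős–Rényi random graphs $\mathbb G(n,1/2)$, then $$\Pr\bigl(|\mathcal A(G_1,G_2,\omega)|\ge(2+\varepsilon)\log_2 n\bigr)\le n^{-c\log n}.$$ -/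

import Mathlib

/-! Online algorithms for the largest common induced subgraph problem on two graphs with vertex
set `Fin n`. The components of a pair (indices `1` and `2`) refer to the first and the second
graph, respectively. -/

namespace LCIS

/-- The vertex sets maintained by an online algorithm: `P₁`, `P₂` are the vertices of the two graphs
processed so far, and `S₁`, `S₂` are the vertex sets of the current partial solution. -/
structure State (n : ℕ) where
  P₁ : Finset (Fin n)
  P₂ : Finset (Fin n)
  S₁ : Finset (Fin n)
  S₂ : Finset (Fin n)

/-- The initial state, in which all four vertex sets are empty. -/
def State.init (n : ℕ) : State n := ⟨∅, ∅, ∅, ∅⟩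

/-- The induced subgraph `G[P]`, recorded as a graph on the whole vertex set in which all pairs
that are not contained in `P` are non-adjacent. Together with `P` it carries exactly the edge
statuses of the pairs contained in `P`. -/
def revealed {n : ℕ} (G : SimpleGraph (Fin n)) (P : Finset (Fin n)) : SimpleGraph (Fin n) :=
  (G.induce (P : Set (Fin n))).spanningCoe

/-- The information available to the algorithm: the sets `P₁`, `P₂`, `S₁`, `S₂` together with the
revealed induced subgraphs `H₁ = G₁[P₁]` and `H₂ = G₂[P₂]`. -/
structure View (n : ℕ) extends State n where
  H₁ : SimpleGraph (Fin n)
  H₂ : SimpleGraph (Fin n)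

/-- What is visible in state `s` when the input is `(G₁, G₂)`. -/
def State.view {n : ℕ} (s : State n) (G₁ G₂ : SimpleGraph (Fin n)) : View n where
  toState := s
  H₁ := revealed G₁ s.P₁
  H₂ := revealed G₂ s.P₂

/-- The decision rules of an algorithm with seeds in `Ω`. Decisions are arbitrary functions of the
seed and of the revealed information.

* `select ω I` is the vertex pair processed next, where `I` is the information available at the end
  of the previous round.
* `update ω I v` is the change made to the solution once the pair `v` has been processed, where
  `I` is the information available after processing `v` (with the solution of the previous round):
  `none` leaves the solution unchanged, and `some w` adds `w.1` to `S₁` and `w.2` to `S₂`. -/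
structure Rules (n : ℕ) (Ω : Type*) where
  select : Ω → View n → Fin n × Fin n
  update : Ω → View n → Fin n × Fin n → Option (Fin n × Fin n)

/-- Process the vertex pair `v`. -/
def State.process {n : ℕ} (s : State n) (v : Fin n × Fin n) : State n :=
  { s with P₁ := insert v.1 s.P₁, P₂ := insert v.2 s.P₂ }

/-- Update the solution. -/
def State.extend {n : ℕ} (s : State n) : Option (Fin n × Fin n) → State n
  | none => s
  | some w => { s with S₁ := insert w.1 s.S₁, S₂ := insert w.2 s.S₂ }

namespace Rules

variable {n : ℕ} {Ω : Type*}

/-- The vertex pair processed in the round that starts in state `s`. -/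
def nextPair (A : Rules n Ω) (ω : Ω) (G₁ G₂ : SimpleGraph (Fin n)) (s : State n) :
    Fin n × Fin n :=
  A.select ω (s.view G₁ G₂)

/-- The state within the round that starts in `s`, after the first and before the second step. -/
def midState (A : Rules n Ω) (ω : Ω) (G₁ G₂ : SimpleGraph (Fin n)) (s : State n) : State n :=
  s.process (A.nextPair ω G₁ G₂ s)

/-- The change to the solution chosen in the round that starts in state `s`. -/
def nextUpdate (A : Rules n Ω) (ω : Ω) (G₁ G₂ : SimpleGraph (Fin n)) (s : State n) :
    Option (Fin n × Fin n) :=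
  A.update ω ((A.midState ω G₁ G₂ s).view G₁ G₂) (A.nextPair ω G₁ G₂ s)

/-- The state at the end of round `t`. -/
def state (A : Rules n Ω) (ω : Ω) (G₁ G₂ : SimpleGraph (Fin n)) : ℕ → State n
  | 0 => State.init n
  | t + 1 =>
    let s := A.state ω G₁ G₂ t
    (A.midState ω G₁ G₂ s).extend (A.nextUpdate ω G₁ G₂ s)

/-- The rules describe an online algorithm if, for all seeds and all inputs, in each of the rounds
`1, …, n` the two processed vertices have not been processed before, the two added vertices (if
any) have both been processed and at least one of them is processed in the present round, and the
two parts of the solution induce isomorphic subgraphs at the end of the round. -/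
structure IsOnline (A : Rules n Ω) : Prop where
  fresh : ∀ (ω : Ω) (G₁ G₂ : SimpleGraph (Fin n)) (t : ℕ), t < n →
    (A.nextPair ω G₁ G₂ (A.state ω G₁ G₂ t)).1 ∉ (A.state ω G₁ G₂ t).P₁ ∧
    (A.nextPair ω G₁ G₂ (A.state ω G₁ G₂ t)).2 ∉ (A.state ω G₁ G₂ t).P₂
  allowed : ∀ (ω : Ω) (G₁ G₂ : SimpleGraph (Fin n)) (t : ℕ), t < n →
    ∀ w : Fin n × Fin n, A.nextUpdate ω G₁ G₂ (A.state ω G₁ G₂ t) = some w →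
      w.1 ∈ (A.midState ω G₁ G₂ (A.state ω G₁ G₂ t)).P₁ ∧
      w.2 ∈ (A.midState ω G₁ G₂ (A.state ω G₁ G₂ t)).P₂ ∧
      (w.1 = (A.nextPair ω G₁ G₂ (A.state ω G₁ G₂ t)).1 ∨
        w.2 = (A.nextPair ω G₁ G₂ (A.state ω G₁ G₂ t)).2)
  iso : ∀ (ω : Ω) (G₁ G₂ : SimpleGraph (Fin n)) (t : ℕ), t < n →
    Nonempty (G₁.induce ((A.state ω G₁ G₂ (t + 1)).S₁ : Set (Fin n)) ≃g
      G₂.induce ((A.state ω G₁ G₂ (t + 1)).S₂ : Set (Fin n)))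

/-- The size of the output, which is the solution at the end of round `n`. For an online algorithm
it equals the size of `S₂` as well, since the two induced subgraphs are isomorphic. -/
def outputSize (A : Rules n Ω) (ω : Ω) (G₁ G₂ : SimpleGraph (Fin n)) : ℕ :=
  (A.state ω G₁ G₂ n).S₁.card

end Rules

/-- The class of online algorithms with seeds in `Ω` for input graphs on `n` vertices. -/
def Online (n : ℕ) (Ω : Type*) : Set (Rules n Ω) := {A | A.IsOnline}

/-- The law of a pair of independent random graphs on `Fin n` in which every pair of distinct
vertices is adjacent independently with probability `1/2`. -/
noncomputable def randomPair (n : ℕ) :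
    MeasureTheory.Measure (SimpleGraph (Fin n) × SimpleGraph (Fin n)) :=
  (SimpleGraph.binomialRandom (Fin n) ⟨1 / 2, by norm_num, by norm_num⟩).prod
    (SimpleGraph.binomialRandom (Fin n) ⟨1 / 2, by norm_num, by norm_num⟩)

end LCIS

/-! Fix the seed, so that the algorithm is deterministic. When a fresh vertex `v` is processed in
one graph, its adjacencies to the current solution there, of size `j`, are still uniform given the
past and the other graph. For a prescribed partner `w` and a prescribed isomorphism these `j` bits
must match a fixed pattern, which has probability `2 ^ (-j)`. With at most `n` partners and `n`
rounds, growth beyond `2 * log₂ n` is unlikely in each further step.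

The isomorphism may change completely from one round to the next, so the proof tracks all of them.
The potential is the number of isomorphisms between the two parts, times `L ^ j`. An extension sends
`v` to one of `j + 1` vertices, and the remaining part is counted by at most the old number of
isomorphisms (`sum_isoCount_flipRow_le`). Summing over all partners makes the bound independent of
the update rule. If `L * 2n²(j + 1) ≤ 2 ^ j` for all `j ≥ k`, each graph adds at most a fraction `1
/ (2n)` to the mean potential per round (`sum_extensionPotential_flipRow_le`), hence a factor at
most `e` over `n` rounds. Below size `k` the potential is frozen at `k ^ k * L ^ k`, so no
randomness is needed there. Markov's inequality bounds the probability of size `m` by `e * k ^ k * L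
^ (k - m)` (`outputSize_tail`). The theorem takes `k` near `(2 + ε/2) log₂ n` and `L = n ^ (ε/4)`.
-/

namespace LCIS

open Finset

/-! ### Counting isomorphisms and resampling one row of a graph -/

section IsoCount

variable {V : Type*}

/-- The number of isomorphisms from `G[S]` to `H[T]`. -/
noncomputable def isoCount (G : SimpleGraph V) (S : Finset V) (H : SimpleGraph V) (T : Finset V) :
    ℕ :=
  Nat.card (G.induce (S : Set V) ≃g H.induce (T : Set V))

lemma isoCount_comm (G : SimpleGraph V) (S : Finset V) (H : SimpleGraph V) (T : Finset V) :
    isoCount G S H T = isoCount H T G S :=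
  Nat.card_congr ⟨RelIso.symm, RelIso.symm, fun _ => rfl, fun _ => rfl⟩

/-- If `G[S]` and `H[T]` are isomorphic, there are at most as many isomorphisms from `G[S]` to
another graph as there are from `G[S]` to `H[T]`. -/
lemma isoCount_le_of_nonempty {G H H' : SimpleGraph V} {S T T' : Finset V}
    (h : Nonempty (G.induce (S : Set V) ≃g H.induce (T : Set V))) :
    isoCount G S H' T' ≤ isoCount G S H T := by
  rcases isEmpty_or_nonempty (G.induce (S : Set V) ≃g H'.induce (T' : Set V)) with h' | ⟨⟨ψ⟩⟩
  · simp [isoCount]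
  · obtain ⟨φ⟩ := h
    -- Composition with the fixed isomorphism `ψ⁻¹φ` from the second target to the first is a
    -- bijection, so the two counts are even equal here.
    refine (Nat.card_congr ⟨fun χ => χ.trans (ψ.symm.trans φ), fun χ => χ.trans (φ.symm.trans ψ),
      fun χ => ?_, fun χ => ?_⟩).le <;>
    · refine RelIso.ext fun x => ?_
      simp

section FlipRow

variable [DecidableEq V]

/-- Switch the adjacency between `v` and the vertices in `B`. -/
def flipRow (G : SimpleGraph V) (v : V) (B : Finset V) : SimpleGraph V where
  Adj a b := a ≠ b ∧ (G.Adj a b ↔ ¬((a = v ∧ b ∈ B) ∨ (b = v ∧ a ∈ B)))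
  symm := ⟨by
    intro a b h
    rw [G.adj_comm b a]
    tauto⟩
  loopless := ⟨fun a h => h.1 rfl⟩

lemma flipRow_flipRow (G : SimpleGraph V) (v : V) (B : Finset V) :
    flipRow (flipRow G v B) v B = G := by
  ext a b
  have := G.ne_of_adj (a := a) (b := b)
  simp only [flipRow]
  tauto

lemma flipRow_adj_of_ne {G : SimpleGraph V} {v : V} {B : Finset V} {a b : V} (ha : a ≠ v)
    (hb : b ≠ v) : (flipRow G v B).Adj a b ↔ G.Adj a b := by
  have := G.ne_of_adj (a := a) (b := b)
  simp only [flipRow]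
  tauto

lemma flipRow_adj_left {G : SimpleGraph V} {v : V} {B : Finset V} {b : V} (hb : b ≠ v) :
    (flipRow G v B).Adj v b ↔ (G.Adj v b ↔ b ∉ B) := by
  simp only [flipRow]
  tauto

end FlipRow

variable [Fintype V] [DecidableEq V]

open Classical in
/-- The maps `V → V` that restrict to an isomorphism from `G[S]` to `H[T]` and fix every vertex
outside of `S`. -/
noncomputable def isoSet (G : SimpleGraph V) (S : Finset V) (H : SimpleGraph V) (T : Finset V) :
    Finset (V → V) :=
  univ.filter fun f => (∀ x, x ∉ S → f x = x) ∧ Set.InjOn f S ∧ S.image f = T ∧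
    ∀ x ∈ S, ∀ y ∈ S, (G.Adj x y ↔ H.Adj (f x) (f y))

lemma mem_isoSet {G H : SimpleGraph V} {S T : Finset V} {f : V → V} :
    f ∈ isoSet G S H T ↔ (∀ x, x ∉ S → f x = x) ∧ Set.InjOn f S ∧ S.image f = T ∧
      ∀ x ∈ S, ∀ y ∈ S, (G.Adj x y ↔ H.Adj (f x) (f y)) := by
  simp [isoSet]

lemma mapsTo_of_mem_isoSet {G H : SimpleGraph V} {S T : Finset V} {f : V → V}
    (hf : f ∈ isoSet G S H T) {x : V} (hx : x ∈ S) : f x ∈ T := by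
  rw [mem_isoSet] at hf
  rw [← hf.2.2.1]
  exact mem_image_of_mem f hx

/-- The isomorphism from `G[S]` to `H[T]` given by an element of `isoSet G S H T`. -/
noncomputable def isoOfMem {G H : SimpleGraph V} {S T : Finset V} {f : V → V}
    (hf : f ∈ isoSet G S H T) : G.induce (S : Set V) ≃g H.induce (T : Set V) where
  toEquiv := Equiv.ofBijective
    (fun x : (S : Set V) => (⟨f x, mapsTo_of_mem_isoSet hf x.2⟩ : (T : Set V))) (by
      rw [mem_isoSet] at hf
      refine ⟨fun x y hxy => Subtype.ext (hf.2.1 x.2 y.2 (congrArg Subtype.val hxy)), ?_⟩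
      rintro ⟨y, hy⟩
      have hy' : y ∈ S.image f := by rw [hf.2.2.1]; exact hy
      obtain ⟨x, hx, rfl⟩ := mem_image.1 hy'
      exact ⟨⟨x, hx⟩, rfl⟩)
  map_rel_iff' := by
    intro x y
    exact ((mem_isoSet.1 hf).2.2.2 x x.2 y y.2).symm

/-- The extension of an isomorphism by the identity. -/
noncomputable def extendIso {G H : SimpleGraph V} {S T : Finset V}
    (φ : G.induce (S : Set V) ≃g H.induce (T : Set V)) (x : V) : V :=
  if h : x ∈ S then (φ ⟨x, h⟩ : V) else x

lemma extendIso_mem {G H : SimpleGraph V} {S T : Finset V}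
    (φ : G.induce (S : Set V) ≃g H.induce (T : Set V)) : extendIso φ ∈ isoSet G S H T := by
  rw [mem_isoSet]
  refine ⟨fun x hx => by simp [extendIso, hx], ?_, ?_, ?_⟩
  · intro x hx y hy hxy
    have hx' : x ∈ S := hx
    have hy' : y ∈ S := hy
    simp only [extendIso, hx', hy', dif_pos] at hxy
    exact congrArg Subtype.val (φ.injective (Subtype.ext hxy))
  · ext y
    simp only [mem_image]
    constructor
    · rintro ⟨x, hx, rfl⟩
      simp only [extendIso, hx, dif_pos]
      exact (φ ⟨x, hx⟩).2
    · intro hy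
      obtain ⟨⟨x, hx⟩, hxy⟩ := φ.surjective ⟨y, hy⟩
      have hx' : x ∈ S := hx
      refine ⟨x, hx', ?_⟩
      simp only [extendIso, hx', dif_pos, hxy]
  · intro x hx y hy
    simp only [extendIso, hx, hy, dif_pos]
    exact (φ.map_rel_iff' (a := ⟨x, hx⟩) (b := ⟨y, hy⟩)).symm

/-- Realising isomorphisms as self-maps of `V` puts those with different source or target sets in
one type, where restriction is just `Function.update`. -/
lemma card_isoSet (G : SimpleGraph V) (S : Finset V) (H : SimpleGraph V) (T : Finset V) :
    #(isoSet G S H T) = isoCount G S H T := by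
  rw [isoCount, ← Fintype.card_coe, ← Nat.card_eq_fintype_card]
  refine Nat.card_congr
    { toFun := fun f => isoOfMem f.2
      invFun := fun φ => ⟨extendIso φ, extendIso_mem φ⟩
      left_inv := ?_
      right_inv := ?_ }
  · rintro ⟨f, hf⟩
    refine Subtype.ext (funext fun x => ?_)
    by_cases hx : x ∈ S
    · simp only [extendIso, hx, dif_pos]
      rfl
    · simp [extendIso, hx, (mem_isoSet.1 hf).1 x hx]
  · intro φ
    refine RelIso.ext fun x => Subtype.ext ?_
    have hx : (x : V) ∈ S := x.2
    change extendIso φ x = _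
    simp only [extendIso, hx, dif_pos]

lemma isoCount_pos {G H : SimpleGraph V} {S T : Finset V}
    (h : Nonempty (G.induce (S : Set V) ≃g H.induce (T : Set V))) : 0 < isoCount G S H T := by
  obtain ⟨φ⟩ := h
  rw [← card_isoSet, card_pos]
  exact ⟨_, extendIso_mem φ⟩

lemma isoCount_le_pow (G : SimpleGraph V) (S : Finset V) (H : SimpleGraph V) (T : Finset V) :
    isoCount G S H T ≤ #T ^ #S := by
  rw [← card_isoSet]
  have hsub : isoSet G S H T ⊆ Fintype.piFinset fun x => if x ∈ S then T else {x} := by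
    intro f hf
    rw [Fintype.mem_piFinset]
    intro x
    by_cases hx : x ∈ S
    · simpa [hx] using mapsTo_of_mem_isoSet hf hx
    · simpa [hx] using (mem_isoSet.1 hf).1 x hx
  refine (card_le_card hsub).trans ?_
  rw [Fintype.card_piFinset]
  have : ∀ x, #(if x ∈ S then T else {x}) = if x ∈ S then #T else 1 := by
    intro x; split_ifs <;> simp
  simp only [this]
  rw [prod_ite]
  simp

/-- Resampling the adjacency between `v` and a vertex set `S`, where `v` and `S` may depend on the
remaining part of the graph. -/
lemma sum_le_sum_of_resample (v : SimpleGraph V → V) (S : SimpleGraph V → Finset V)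
    (hv : ∀ G A, v (flipRow G (v G) (A ∩ S G)) = v G)
    (hS : ∀ G A, S (flipRow G (v G) (A ∩ S G)) = S G) (Ψ Θ : SimpleGraph V → ℝ)
    (h : ∀ G, ∑ A : Finset V, Ψ (flipRow G (v G) (A ∩ S G)) ≤ 2 ^ Fintype.card V * Θ G) :
    ∑ G, Ψ G ≤ ∑ G, Θ G := by
  -- For fixed `A` the flip is an involution on graphs, because it changes neither `v` nor `S`. It
  -- therefore only permutes the terms of the sum.
  have key : ∀ A : Finset V, ∑ G, Ψ (flipRow G (v G) (A ∩ S G)) = ∑ G, Ψ G := by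
    intro A
    have hinv : Function.Involutive fun G : SimpleGraph V => flipRow G (v G) (A ∩ S G) := by
      intro G
      simp only [hv, hS, flipRow_flipRow]
    exact Equiv.sum_comp (hinv.toPerm _) Ψ
  have h2 : (2 : ℝ) ^ Fintype.card V * ∑ G, Ψ G ≤ 2 ^ Fintype.card V * ∑ G, Θ G := by
    rw [mul_sum univ Θ]
    refine le_trans (le_of_eq ?_) (sum_le_sum fun G _ => h G)
    rw [sum_comm]
    simp only [key, sum_const, card_univ, Fintype.card_finset, nsmul_eq_mul]
    push_cast
    ring
  exact le_of_mul_le_mul_left h2 (by positivity)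

/-- Averaged over the adjacency between `v` and `S`, the number of isomorphisms between one-vertex
extensions of `G[S]` and `H[T]` is at most `(#T + 1) * 2 ^ (-#S)` times the number of isomorphisms
from `G[S]` to `H[T]`. -/
lemma sum_isoCount_flipRow_le {G H : SimpleGraph V} {S T : Finset V}
    (hiso : Nonempty (G.induce (S : Set V) ≃g H.induce (T : Set V))) {v w : V} (hv : v ∉ S) :
    ∑ A : Finset V, isoCount (flipRow G v (A ∩ S)) (insert v S) H (insert w T) ≤
      (#T + 1) * isoCount G S H T * 2 ^ (Fintype.card V - #S) := by
  classical
  simp only [← card_isoSet (flipRow _ _ _)]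
  rw [← card_sigma]
  -- Encode `(A, f)` by the image of `v`, the restriction of `f` to `S`, and the part of `A` outside
  -- `S`, which has no effect on the flip.
  have hmaps : ∀ p ∈ (univ : Finset (Finset V)).sigma fun A =>
      isoSet (flipRow G v (A ∩ S)) (insert v S) H (insert w T),
      (⟨p.2 v, Function.update p.2 v v, p.1 \ S⟩ : Σ _ : V, (V → V) × Finset V) ∈
        (insert w T).sigma fun u => (isoSet G S H ((insert w T).erase u)) ×ˢ (Sᶜ).powerset := by
    rintro ⟨A, f⟩ hp
    have hf := (mem_sigma.1 hp).2
    simp only at hf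
    have hfv := mapsTo_of_mem_isoSet hf (mem_insert_self v S)
    have hne : ∀ x ∈ S, x ≠ v := fun x hx h => hv (h ▸ hx)
    rw [mem_isoSet] at hf
    obtain ⟨h1, h2, h3, h4⟩ := hf
    simp only [mem_sigma, mem_product, mem_powerset]
    refine ⟨hfv, ?_, ?_⟩
    · rw [mem_isoSet]
      refine ⟨?_, ?_, ?_, ?_⟩
      · intro x hx
        by_cases hxv : x = v
        · simp [hxv]
        · simp [Function.update_of_ne hxv, h1 x (by simp [hx, hxv])]
      · intro x hx y hy hxy
        rw [Function.update_of_ne (hne x hx), Function.update_of_ne (hne y hy)] at hxy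
        exact h2 (by simp [mem_coe.1 hx]) (by simp [mem_coe.1 hy]) hxy
      · rw [← h3, image_insert]
        have hnot : f v ∉ S.image f := by
          rw [mem_image]
          rintro ⟨x, hx, hxv⟩
          exact hne x hx (h2 (by simp [hx]) (by simp) hxv)
        rw [erase_insert hnot]
        exact image_congr fun x hx => Function.update_of_ne (hne x hx) _ _
      · intro x hx y hy
        rw [Function.update_of_ne (hne x hx), Function.update_of_ne (hne y hy),
          ← h4 x (by simp [hx]) y (by simp [hy]), flipRow_adj_of_ne (hne x hx) (hne y hy)]
    · intro x hx
      simp only [mem_sdiff] at hx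
      simpa using hx.2
  have hinj : Set.InjOn (fun p : Σ _ : Finset V, (V → V) =>
      (⟨p.2 v, Function.update p.2 v v, p.1 \ S⟩ : Σ _ : V, (V → V) × Finset V))
      ((univ : Finset (Finset V)).sigma fun A =>
        isoSet (flipRow G v (A ∩ S)) (insert v S) H (insert w T)) := by
    rintro ⟨A, f⟩ hp ⟨B, g⟩ hq heq
    have hf := (mem_isoSet.1 (mem_sigma.1 hp).2).2.2.2
    have hg := (mem_isoSet.1 (mem_sigma.1 hq).2).2.2.2
    simp only [Sigma.mk.injEq, heq_eq_eq, Prod.mk.injEq] at heq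
    obtain ⟨e1, e2, e3⟩ := heq
    have hfg : f = g := by
      funext x
      by_cases hx : x = v
      · rw [hx, e1]
      · simpa [Function.update_of_ne hx] using congrFun e2 x
    subst hfg
    -- The isomorphism `f` prescribes every adjacency between `v` and `S`, so `A ∩ S` can be
    -- recovered from `f`. This is the source of the factor `2 ^ (-#S)`.
    have hAB : A = B := by
      ext x
      by_cases hx : x ∈ S
      · have hxv : x ≠ v := fun h => hv (h ▸ hx)
        have a1 := hf v (by simp) x (by simp [hx])
        have a2 := hg v (by simp) x (by simp [hx])
        rw [flipRow_adj_left hxv] at a1 a2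
        simp only [mem_inter, hx, and_true] at a1 a2
        tauto
      · have := Finset.ext_iff.1 e3 x
        simpa [hx] using this
    rw [hAB]
  refine (card_le_card_of_injOn _ hmaps hinj).trans ?_
  rw [card_sigma]
  calc ∑ u ∈ insert w T, #((isoSet G S H ((insert w T).erase u)) ×ˢ (Sᶜ).powerset)
      ≤ ∑ u ∈ insert w T, isoCount G S H T * 2 ^ (Fintype.card V - #S) := by
        -- The target `insert w T` minus `u` need not be `T`, but it never admits more isomorphisms
        -- than `T`, as `G[S]` and `H[T]` are isomorphic.
        refine sum_le_sum fun u _ => ?_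
        rw [card_product, card_powerset, card_compl, card_isoSet]
        exact Nat.mul_le_mul_right _ (isoCount_le_of_nonempty hiso)
    _ ≤ _ := by
        rw [sum_const, smul_eq_mul, mul_assoc]
        exact Nat.mul_le_mul_right _ (card_insert_le w T)

end IsoCount

end LCIS

namespace LCIS

open Finset

/-! ### Locality of the algorithm and invariants of its states -/

section Dynamics

variable {n : ℕ} {Ω : Type*} {A : Rules n Ω} {ω : Ω} {G₁ G₂ : SimpleGraph (Fin n)} {t : ℕ}

/-- Two graphs agree on the vertex set `P`. -/
def AgreeOn (G G' : SimpleGraph (Fin n)) (P : Finset (Fin n)) : Prop :=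
  ∀ x ∈ P, ∀ y ∈ P, (G.Adj x y ↔ G'.Adj x y)

lemma AgreeOn.refl (G : SimpleGraph (Fin n)) (P : Finset (Fin n)) : AgreeOn G G P :=
  fun _ _ _ _ => Iff.rfl

lemma AgreeOn.mono {G G' : SimpleGraph (Fin n)} {P Q : Finset (Fin n)} (h : AgreeOn G G' Q)
    (hPQ : P ⊆ Q) : AgreeOn G G' P :=
  fun x hx y hy => h x (hPQ hx) y (hPQ hy)

lemma agreeOn_flipRow (G : SimpleGraph (Fin n)) {v : Fin n} {P : Finset (Fin n)} (hv : v ∉ P)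
    (B : Finset (Fin n)) : AgreeOn G (flipRow G v B) P :=
  fun _ hx _ hy =>
    (flipRow_adj_of_ne (ne_of_mem_of_not_mem hx hv) (ne_of_mem_of_not_mem hy hv)).symm

lemma AgreeOn.revealed_eq {G G' : SimpleGraph (Fin n)} {P : Finset (Fin n)}
    (h : AgreeOn G G' P) : revealed G P = revealed G' P := by
  ext x y
  simp only [revealed, SimpleGraph.map_adj, SimpleGraph.comap_adj]
  constructor <;>
  · rintro ⟨a, b, hab, rfl, rfl⟩
    refine ⟨a, b, ?_, rfl, rfl⟩
    have := h a a.2 b b.2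
    simp only [Function.Embedding.subtype_apply] at hab ⊢
    tauto

lemma State.view_eq_of_agreeOn {G₁' G₂' : SimpleGraph (Fin n)} {s : State n}
    (h₁ : AgreeOn G₁ G₁' s.P₁) (h₂ : AgreeOn G₂ G₂' s.P₂) : s.view G₁ G₂ = s.view G₁' G₂' := by
  simp only [State.view, h₁.revealed_eq, h₂.revealed_eq]

@[simp] lemma State.extend_P₁ (s : State n) (o : Option (Fin n × Fin n)) :
    (s.extend o).P₁ = s.P₁ := by
  cases o <;> rfl

@[simp] lemma State.extend_P₂ (s : State n) (o : Option (Fin n × Fin n)) :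
    (s.extend o).P₂ = s.P₂ := by
  cases o <;> rfl

namespace Rules

lemma state_succ (A : Rules n Ω) (ω : Ω) (G₁ G₂ : SimpleGraph (Fin n)) (t : ℕ) :
    A.state ω G₁ G₂ (t + 1) = (A.midState ω G₁ G₂ (A.state ω G₁ G₂ t)).extend
      (A.nextUpdate ω G₁ G₂ (A.state ω G₁ G₂ t)) :=
  rfl

/-- The state after `t` rounds only depends on the parts of the graphs revealed so far. -/
lemma state_eq_of_agreeOn {G₁' G₂' : SimpleGraph (Fin n)}
    (h₁ : AgreeOn G₁ G₁' (A.state ω G₁ G₂ t).P₁) (h₂ : AgreeOn G₂ G₂' (A.state ω G₁ G₂ t).P₂) :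
    A.state ω G₁' G₂' t = A.state ω G₁ G₂ t := by
  induction t with
  | zero => rfl
  | succ t ih =>
    rw [state_succ, State.extend_P₁] at h₁
    rw [state_succ, State.extend_P₂] at h₂
    have g₁ : AgreeOn G₁ G₁' (A.state ω G₁ G₂ t).P₁ := h₁.mono (subset_insert _ _)
    have g₂ : AgreeOn G₂ G₂' (A.state ω G₁ G₂ t).P₂ := h₂.mono (subset_insert _ _)
    have hs := ih g₁ g₂
    have hmid : A.midState ω G₁' G₂' (A.state ω G₁ G₂ t) =
        A.midState ω G₁ G₂ (A.state ω G₁ G₂ t) := by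
      simp only [midState, nextPair, State.view_eq_of_agreeOn g₁ g₂]
    rw [state_succ, state_succ, hs]
    simp only [nextUpdate, hmid, State.view_eq_of_agreeOn h₁ h₂]
    simp only [nextPair, State.view_eq_of_agreeOn g₁ g₂]

lemma nextPair_eq_of_agreeOn {G₁' G₂' : SimpleGraph (Fin n)}
    (h₁ : AgreeOn G₁ G₁' (A.state ω G₁ G₂ t).P₁) (h₂ : AgreeOn G₂ G₂' (A.state ω G₁ G₂ t).P₂) :
    A.nextPair ω G₁' G₂' (A.state ω G₁' G₂' t) = A.nextPair ω G₁ G₂ (A.state ω G₁ G₂ t) := by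
  rw [state_eq_of_agreeOn h₁ h₂]
  simp only [nextPair, State.view_eq_of_agreeOn h₁ h₂]

/-- Together with freshness this shows that a newly processed vertex lies outside the solution, as
the resampling estimate requires. -/
lemma IsOnline.subset_processed (hA : A.IsOnline) (ω : Ω) (G₁ G₂ : SimpleGraph (Fin n))
    (ht : t ≤ n) : (A.state ω G₁ G₂ t).S₁ ⊆ (A.state ω G₁ G₂ t).P₁ ∧
      (A.state ω G₁ G₂ t).S₂ ⊆ (A.state ω G₁ G₂ t).P₂ := by
  induction t with
  | zero => exact ⟨Subset.refl _, Subset.refl _⟩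
  | succ t ih =>
    obtain ⟨i₁, i₂⟩ := ih (by omega)
    have m₁ : (A.state ω G₁ G₂ t).S₁ ⊆ (A.midState ω G₁ G₂ (A.state ω G₁ G₂ t)).P₁ :=
      i₁.trans (subset_insert _ _)
    have m₂ : (A.state ω G₁ G₂ t).S₂ ⊆ (A.midState ω G₁ G₂ (A.state ω G₁ G₂ t)).P₂ :=
      i₂.trans (subset_insert _ _)
    rw [state_succ, State.extend_P₁, State.extend_P₂]
    rcases h : A.nextUpdate ω G₁ G₂ (A.state ω G₁ G₂ t) with _ | w
    · exact ⟨m₁, m₂⟩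
    · obtain ⟨a₁, a₂, -⟩ := hA.allowed ω G₁ G₂ t (by omega) w h
      exact ⟨insert_subset a₁ m₁, insert_subset a₂ m₂⟩

lemma IsOnline.nonempty_iso (hA : A.IsOnline) (ω : Ω) (G₁ G₂ : SimpleGraph (Fin n))
    (ht : t ≤ n) : Nonempty (G₁.induce ((A.state ω G₁ G₂ t).S₁ : Set (Fin n)) ≃g
      G₂.induce ((A.state ω G₁ G₂ t).S₂ : Set (Fin n))) := by
  cases t with
  | zero =>
    have h : IsEmpty ((∅ : Finset (Fin n)) : Set (Fin n)) := by simp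
    exact ⟨⟨@Equiv.equivOfIsEmpty _ _ h h, fun {a} => (h.false a).elim⟩⟩
  | succ t => exact hA.iso ω G₁ G₂ t (by omega)

lemma IsOnline.card_eq (hA : A.IsOnline) (ω : Ω) (G₁ G₂ : SimpleGraph (Fin n)) (ht : t ≤ n) :
    #(A.state ω G₁ G₂ t).S₁ = #(A.state ω G₁ G₂ t).S₂ := by
  obtain ⟨φ⟩ := hA.nonempty_iso ω G₁ G₂ ht
  simpa using Fintype.card_congr φ.toEquiv

end Rules

/-! ### The potential and its growth under one extension -/

/-- The potential of a partial solution: the number of isomorphisms, weighted by `L` to the size of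
the solution. Below size `k` it is replaced by its largest possible value at size `k`. -/
noncomputable def potential (k : ℕ) (L : ℝ) (G : SimpleGraph (Fin n)) (S : Finset (Fin n))
    (H : SimpleGraph (Fin n)) (T : Finset (Fin n)) : ℝ :=
  if #S < k then (k : ℝ) ^ k * L ^ k else isoCount G S H T * L ^ #S

/-- The total potential of all extensions of a partial solution of size at least `k` by the vertex
`v` in the first graph and any vertex in the second graph. -/
noncomputable def extensionPotential (k : ℕ) (L : ℝ) (G : SimpleGraph (Fin n))
    (S : Finset (Fin n)) (v : Fin n) (H : SimpleGraph (Fin n)) (T : Finset (Fin n)) : ℝ :=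
  if k ≤ #S then ∑ w ∈ Tᶜ, isoCount G (insert v S) H (insert w T) * L ^ (#S + 1) else 0

/-- Lets one estimate serve extensions in either graph. Equal sizes are needed because the potential
reads the size off its first set only. -/
lemma potential_comm (k : ℕ) (L : ℝ) (G : SimpleGraph (Fin n)) {S : Finset (Fin n)}
    (H : SimpleGraph (Fin n)) {T : Finset (Fin n)} (h : #S = #T) :
    potential k L G S H T = potential k L H T G S := by
  simp only [potential, h, isoCount_comm G S H T]

lemma potential_nonneg {k : ℕ} {L : ℝ} (hL : 0 ≤ L) (G : SimpleGraph (Fin n))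
    (S : Finset (Fin n)) (H : SimpleGraph (Fin n)) (T : Finset (Fin n)) :
    0 ≤ potential k L G S H T := by
  unfold potential
  split_ifs <;> positivity

lemma extensionPotential_nonneg {k : ℕ} {L : ℝ} (hL : 0 ≤ L) (G : SimpleGraph (Fin n))
    (S : Finset (Fin n)) (v : Fin n) (H : SimpleGraph (Fin n)) (T : Finset (Fin n)) :
    0 ≤ extensionPotential k L G S v H T := by
  unfold extensionPotential
  split_ifs <;> positivity

/-- From size `k` on, the new potential is a single term of the nonnegative sum over all `w`. Below
it, the frozen value already dominates. -/
lemma potential_insert_le {k : ℕ} {L : ℝ} (hL : 0 ≤ L) {G H : SimpleGraph (Fin n)}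
    {S T : Finset (Fin n)} (hST : #S = #T) {v w : Fin n} (hv : v ∉ S) (hw : w ∉ T) :
    potential k L G (insert v S) H (insert w T) ≤
      potential k L G S H T + extensionPotential k L G S v H T := by
  by_cases hk : k ≤ #S
  · refine le_trans ?_ (le_add_of_nonneg_left (potential_nonneg hL _ _ _ _))
    rw [potential, card_insert_of_notMem hv, if_neg (by omega), extensionPotential, if_pos hk]
    exact single_le_sum
      (f := fun w => (isoCount G (insert v S) H (insert w T) : ℝ) * L ^ (#S + 1))
      (fun _ _ => by positivity) (by simpa using hw)
  · rw [extensionPotential, if_neg hk, add_zero]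
    rw [potential, potential, card_insert_of_notMem hv, if_pos (by omega : #S < k)]
    split_ifs with h
    · exact le_rfl
    · have hk' : k = #S + 1 := by omega
      have := isoCount_le_pow G (insert v S) H (insert w T)
      rw [card_insert_of_notMem hv, card_insert_of_notMem hw, ← hST, ← hk'] at this
      rw [← hk']
      gcongr
      exact_mod_cast this

/-- Averaged over the adjacency between the new vertex `v` and the partial solution, the total
potential of all extensions by `v` is at most `1 / (2 * n)` times the current potential. -/
lemma sum_extensionPotential_flipRow_le {k : ℕ} {L : ℝ} (hL : 0 ≤ L)
    (hkL : ∀ j : ℕ, k ≤ j → L * (2 * (n : ℝ) ^ 2 * (j + 1)) ≤ 2 ^ j)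
    {G H : SimpleGraph (Fin n)} {S T : Finset (Fin n)}
    (hiso : Nonempty (G.induce (S : Set (Fin n)) ≃g H.induce (T : Set (Fin n))))
    (hST : #S = #T) {v : Fin n} (hv : v ∉ S) :
    ∑ A : Finset (Fin n), extensionPotential k L (flipRow G v (A ∩ S)) S v H T ≤
      2 ^ Fintype.card (Fin n) * (potential k L G S H T / (2 * n)) := by
  have hn : (0 : ℝ) < n := by
    have := v.pos
    exact_mod_cast this
  by_cases hk : k ≤ #S
  swap
  · simp only [extensionPotential, if_neg hk, sum_const_zero]
    have := potential_nonneg (k := k) hL G S H T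
    positivity
  simp only [extensionPotential, if_pos hk, potential, if_neg (not_lt.2 hk)]
  rw [sum_comm]
  have hSn : #S ≤ n := by simpa using card_le_univ S
  have hcount : ∀ w ∈ Tᶜ, ∑ A : Finset (Fin n),
      (isoCount (flipRow G v (A ∩ S)) (insert v S) H (insert w T) : ℝ) * L ^ (#S + 1) ≤
        (#S + 1) * isoCount G S H T * 2 ^ (n - #S) * L ^ (#S + 1) := by
    intro w _
    rw [← sum_mul]
    refine mul_le_mul_of_nonneg_right ?_ (by positivity)
    have := sum_isoCount_flipRow_le hiso (w := w) hv
    rw [← hST, Fintype.card_fin] at this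
    exact_mod_cast this
  refine (sum_le_sum hcount).trans ?_
  rw [sum_const, nsmul_eq_mul, Fintype.card_fin]
  have hT : (#Tᶜ : ℝ) ≤ n := by
    have := card_le_univ Tᶜ
    rw [Fintype.card_fin] at this
    exact_mod_cast this
  have hpow : (2 : ℝ) ^ n = 2 ^ #S * 2 ^ (n - #S) := by
    rw [← pow_add]
    congr 1
    omega
  -- One factor `n` pays for the choice of `w`. The hypothesis on `L` has `2n²`, so a factor `1 /
  -- (2n)` remains.
  calc (#Tᶜ : ℝ) * ((#S + 1) * isoCount G S H T * 2 ^ (n - #S) * L ^ (#S + 1))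
      ≤ n * ((#S + 1) * isoCount G S H T * 2 ^ (n - #S) * L ^ (#S + 1)) := by gcongr
    _ = (L * (2 * (n : ℝ) ^ 2 * (#S + 1))) *
        (2 ^ (n - #S) * (isoCount G S H T * L ^ #S / (2 * n))) := by
        rw [pow_succ]
        field_simp
    _ ≤ 2 ^ #S * (2 ^ (n - #S) * (isoCount G S H T * L ^ #S / (2 * n))) := by
        refine mul_le_mul_of_nonneg_right (hkL _ hk) (by positivity)
    _ = _ := by rw [hpow]; ring

/-! ### Expected potential along the rounds -/

namespace Rules

/-- The potential of the solution at the end of round `t`. -/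
noncomputable def potentialAt (A : Rules n Ω) (ω : Ω) (k : ℕ) (L : ℝ) (t : ℕ)
    (G₁ G₂ : SimpleGraph (Fin n)) : ℝ :=
  potential k L G₁ (A.state ω G₁ G₂ t).S₁ G₂ (A.state ω G₁ G₂ t).S₂

/-- The total potential of all extensions in round `t + 1` that use the new vertex of the first
graph. -/
noncomputable def extension₁ (A : Rules n Ω) (ω : Ω) (k : ℕ) (L : ℝ) (t : ℕ)
    (G₁ G₂ : SimpleGraph (Fin n)) : ℝ :=
  extensionPotential k L G₁ (A.state ω G₁ G₂ t).S₁
    (A.nextPair ω G₁ G₂ (A.state ω G₁ G₂ t)).1 G₂ (A.state ω G₁ G₂ t).S₂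

/-- The total potential of all extensions in round `t + 1` that use the new vertex of the second
graph. -/
noncomputable def extension₂ (A : Rules n Ω) (ω : Ω) (k : ℕ) (L : ℝ) (t : ℕ)
    (G₁ G₂ : SimpleGraph (Fin n)) : ℝ :=
  extensionPotential k L G₂ (A.state ω G₁ G₂ t).S₂
    (A.nextPair ω G₁ G₂ (A.state ω G₁ G₂ t)).2 G₁ (A.state ω G₁ G₂ t).S₁

/-- An accepted pair uses the new vertex of at least one graph, so the corresponding extension sum
covers it, whatever the partner. -/
lemma IsOnline.potentialAt_succ_le (hA : A.IsOnline) (ω : Ω) (k : ℕ) {L : ℝ} (hL : 0 ≤ L)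
    (ht : t < n) (G₁ G₂ : SimpleGraph (Fin n)) :
    A.potentialAt ω k L (t + 1) G₁ G₂ ≤ A.potentialAt ω k L t G₁ G₂ +
      (A.extension₁ ω k L t G₁ G₂ + A.extension₂ ω k L t G₁ G₂) := by
  have hcard := hA.card_eq ω G₁ G₂ ht.le
  have hcard' := hA.card_eq ω G₁ G₂ (t := t + 1) ht
  have he₁ : 0 ≤ A.extension₁ ω k L t G₁ G₂ := extensionPotential_nonneg hL _ _ _ _ _
  have he₂ : 0 ≤ A.extension₂ ω k L t G₁ G₂ := extensionPotential_nonneg hL _ _ _ _ _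
  rw [state_succ] at hcard'
  simp only [potentialAt]
  rw [state_succ]
  rcases h : A.nextUpdate ω G₁ G₂ (A.state ω G₁ G₂ t) with _ | w
  · exact le_add_of_nonneg_right (add_nonneg he₁ he₂)
  · obtain ⟨-, -, hw⟩ := hA.allowed ω G₁ G₂ t ht w h
    rw [h] at hcard'
    simp only [State.extend, midState, State.process] at hcard' ⊢
    -- As both parts keep equal size, the two insertions are either both void or both proper.
    by_cases h₁ : w.1 ∈ (A.state ω G₁ G₂ t).S₁
    · have h₂ : w.2 ∈ (A.state ω G₁ G₂ t).S₂ := by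
        by_contra h₂
        rw [insert_eq_of_mem h₁, card_insert_of_notMem h₂] at hcard'
        omega
      rw [insert_eq_of_mem h₁, insert_eq_of_mem h₂]
      exact le_add_of_nonneg_right (add_nonneg he₁ he₂)
    · have h₂ : w.2 ∉ (A.state ω G₁ G₂ t).S₂ := by
        intro h₂
        rw [insert_eq_of_mem h₂, card_insert_of_notMem h₁] at hcard'
        omega
      rcases hw with hw | hw
      · have := potential_insert_le (k := k) (G := G₁) (H := G₂) hL hcard h₁ h₂
        simp only [extension₁, ← hw]
        linarith
      · have := potential_insert_le (k := k) (G := G₂) (H := G₁) hL hcard.symm h₂ h₁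
        rw [potential_comm _ _ _ _ (by rw [card_insert_of_notMem h₁, card_insert_of_notMem h₂,
          hcard]), potential_comm k L G₁ G₂ hcard]
        simp only [extension₂, ← hw]
        linarith

/-- With `G₂` fixed, resample the row of the new vertex of `G₁` towards the solution. The new vertex
is unrevealed so far, hence the state and the choice of that vertex do not change. -/
lemma IsOnline.sum_extension₁_le (hA : A.IsOnline) (ω : Ω) {k : ℕ} {L : ℝ} (hL : 0 ≤ L)
    (hkL : ∀ j : ℕ, k ≤ j → L * (2 * (n : ℝ) ^ 2 * (j + 1)) ≤ 2 ^ j) (ht : t < n)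
    (G₂ : SimpleGraph (Fin n)) :
    ∑ G₁, A.extension₁ ω k L t G₁ G₂ ≤ ∑ G₁, A.potentialAt ω k L t G₁ G₂ / (2 * n) := by
  have hagree : ∀ G B, AgreeOn G (flipRow G (A.nextPair ω G G₂ (A.state ω G G₂ t)).1 B)
      (A.state ω G G₂ t).P₁ := fun G B => agreeOn_flipRow G (hA.fresh ω G G₂ t ht).1 B
  have hstate := fun G B => state_eq_of_agreeOn (hagree G B) (AgreeOn.refl _ _)
  have hpair := fun G B => nextPair_eq_of_agreeOn (hagree G B) (AgreeOn.refl _ _)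
  refine sum_le_sum_of_resample
    (fun G => (A.nextPair ω G G₂ (A.state ω G G₂ t)).1) (fun G => (A.state ω G G₂ t).S₁)
    (fun G B => by rw [hpair]) (fun G B => by rw [hstate]) _ _ fun G => ?_
  simp only [extension₁, hpair]
  simp only [hstate, potentialAt]
  exact sum_extensionPotential_flipRow_le hL hkL (hA.nonempty_iso ω G G₂ ht.le)
    (hA.card_eq ω G G₂ ht.le)
    fun h => (hA.fresh ω G G₂ t ht).1 ((hA.subset_processed ω G G₂ ht.le).1 h)

lemma IsOnline.sum_extension₂_le (hA : A.IsOnline) (ω : Ω) {k : ℕ} {L : ℝ} (hL : 0 ≤ L)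
    (hkL : ∀ j : ℕ, k ≤ j → L * (2 * (n : ℝ) ^ 2 * (j + 1)) ≤ 2 ^ j) (ht : t < n)
    (G₁ : SimpleGraph (Fin n)) :
    ∑ G₂, A.extension₂ ω k L t G₁ G₂ ≤ ∑ G₂, A.potentialAt ω k L t G₁ G₂ / (2 * n) := by
  have hagree : ∀ G B, AgreeOn G (flipRow G (A.nextPair ω G₁ G (A.state ω G₁ G t)).2 B)
      (A.state ω G₁ G t).P₂ := fun G B => agreeOn_flipRow G (hA.fresh ω G₁ G t ht).2 B
  have hstate := fun G B => state_eq_of_agreeOn (AgreeOn.refl _ _) (hagree G B)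
  have hpair := fun G B => nextPair_eq_of_agreeOn (AgreeOn.refl _ _) (hagree G B)
  refine sum_le_sum_of_resample
    (fun G => (A.nextPair ω G₁ G (A.state ω G₁ G t)).2) (fun G => (A.state ω G₁ G t).S₂)
    (fun G B => by rw [hpair]) (fun G B => by rw [hstate]) _ _ fun G => ?_
  simp only [extension₂, hpair]
  simp only [hstate, potentialAt]
  rw [potential_comm _ _ _ _ (hA.card_eq ω G₁ G ht.le)]
  exact sum_extensionPotential_flipRow_le hL hkL
    ((hA.nonempty_iso ω G₁ G ht.le).map RelIso.symm) (hA.card_eq ω G₁ G ht.le).symm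
    fun h => (hA.fresh ω G₁ G t ht).2 ((hA.subset_processed ω G₁ G ht.le).2 h)

/-- Each graph contributes `1 / (2n)` of the current total. -/
lemma IsOnline.sum_potentialAt_succ_le (hA : A.IsOnline) (ω : Ω) {k : ℕ} {L : ℝ} (hL : 0 ≤ L)
    (hkL : ∀ j : ℕ, k ≤ j → L * (2 * (n : ℝ) ^ 2 * (j + 1)) ≤ 2 ^ j) (ht : t < n) :
    ∑ G₁, ∑ G₂, A.potentialAt ω k L (t + 1) G₁ G₂ ≤
      (1 + 1 / n) * ∑ G₁, ∑ G₂, A.potentialAt ω k L t G₁ G₂ := by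
  have h₁ : ∑ G₁, ∑ G₂, A.extension₁ ω k L t G₁ G₂ ≤
      (∑ G₁, ∑ G₂, A.potentialAt ω k L t G₁ G₂) / (2 * n) := by
    rw [sum_comm, sum_comm (f := fun G₁ G₂ => A.potentialAt ω k L t G₁ G₂), sum_div]
    refine sum_le_sum fun G₂ _ => ?_
    rw [sum_div]
    exact hA.sum_extension₁_le ω hL hkL ht G₂
  have h₂ : ∑ G₁, ∑ G₂, A.extension₂ ω k L t G₁ G₂ ≤
      (∑ G₁, ∑ G₂, A.potentialAt ω k L t G₁ G₂) / (2 * n) := by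
    rw [sum_div]
    refine sum_le_sum fun G₁ _ => ?_
    rw [sum_div]
    exact hA.sum_extension₂_le ω hL hkL ht G₁
  have h₃ : ∑ G₁, ∑ G₂, A.potentialAt ω k L (t + 1) G₁ G₂ ≤
      ∑ G₁, ∑ G₂, (A.potentialAt ω k L t G₁ G₂ +
        (A.extension₁ ω k L t G₁ G₂ + A.extension₂ ω k L t G₁ G₂)) :=
    sum_le_sum fun G₁ _ => sum_le_sum fun G₂ _ => hA.potentialAt_succ_le ω k hL ht G₁ G₂
  simp only [sum_add_distrib] at h₃
  have hn : (n : ℝ) ≠ 0 := by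
    have : n ≠ 0 := by omega
    exact_mod_cast this
  refine h₃.trans ((add_le_add le_rfl (add_le_add h₁ h₂)).trans (le_of_eq ?_))
  field_simp
  ring

/-- The expected potential of the output. -/
lemma IsOnline.sum_potentialAt_le (hA : A.IsOnline) (ω : Ω) {k : ℕ} (hk : 0 < k) {L : ℝ}
    (hL : 0 ≤ L) (hkL : ∀ j : ℕ, k ≤ j → L * (2 * (n : ℝ) ^ 2 * (j + 1)) ≤ 2 ^ j) :
    ∑ G₁, ∑ G₂, A.potentialAt ω k L n G₁ G₂ ≤
      Fintype.card (SimpleGraph (Fin n) × SimpleGraph (Fin n)) *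
        (Real.exp 1 * ((k : ℝ) ^ k * L ^ k)) := by
  have hstep : ∀ t ≤ n, ∑ G₁, ∑ G₂, A.potentialAt ω k L t G₁ G₂ ≤ (1 + 1 / (n : ℝ)) ^ t *
      (Fintype.card (SimpleGraph (Fin n) × SimpleGraph (Fin n)) * ((k : ℝ) ^ k * L ^ k)) := by
    intro t
    induction t with
    | zero =>
      intro _
      refine le_of_eq ?_
      -- Since `0 < k`, the empty solution has the frozen value.
      have : ∀ G₁ G₂, A.potentialAt ω k L 0 G₁ G₂ = (k : ℝ) ^ k * L ^ k := by
        intro G₁ G₂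
        simp [potentialAt, potential, state, State.init, hk]
      simp only [this, sum_const, card_univ, nsmul_eq_mul, pow_zero, one_mul, Fintype.card_prod]
      push_cast
      ring
    | succ t ih =>
      intro ht
      refine (hA.sum_potentialAt_succ_le ω hL hkL (by omega)).trans ?_
      rw [pow_succ', mul_assoc]
      exact mul_le_mul_of_nonneg_left (ih (by omega)) (by positivity)
  refine (hstep n le_rfl).trans ?_
  have hexp : (1 + 1 / (n : ℝ)) ^ n ≤ Real.exp 1 := by
    rcases Nat.eq_zero_or_pos n with rfl | hn
    · simp
    · calc (1 + 1 / (n : ℝ)) ^ n ≤ Real.exp (1 / n) ^ n := by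
            gcongr
            rw [add_comm]
            exact Real.add_one_le_exp _
        _ = Real.exp 1 := by
            rw [← Real.exp_nat_mul]
            congr 1
            field_simp
  calc _ ≤ Real.exp 1 * (Fintype.card (SimpleGraph (Fin n) × SimpleGraph (Fin n)) *
        ((k : ℝ) ^ k * L ^ k)) := by gcongr
    _ = _ := by ring

end Rules

end Dynamics

end LCIS

namespace LCIS

open Finset MeasureTheory

/-! ### Uniformity of the random pair and Markov's inequality -/

section RandomPair

variable {n : ℕ}

instance measurableSingletonClass_simpleGraph :
    MeasurableSingletonClass (SimpleGraph (Fin n)) where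
  measurableSet_singleton G := by
    have h := SimpleGraph.measurable_edgeSet (MeasurableSet.singleton G.edgeSet)
    have hG : SimpleGraph.edgeSet ⁻¹' {G.edgeSet} = {G} := by
      ext H
      simp
    rwa [hG] at h

instance : IsProbabilityMeasure (randomPair n) := by
  unfold randomPair
  infer_instance

/-- At edge probability `1/2` edges and non-edges weigh the same, so the law is uniform and
expectations become plain sums over pairs. -/
lemma randomPair_real_singleton (Y : SimpleGraph (Fin n) × SimpleGraph (Fin n)) :
    (randomPair n).real {Y} = (1 / 2) ^ (n.choose 2) * (1 / 2) ^ (n.choose 2) := by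
  have h : ∀ G : SimpleGraph (Fin n),
      (SimpleGraph.binomialRandom (Fin n) ⟨1 / 2, by norm_num, by norm_num⟩).real {G} =
        (1 / 2) ^ (n.choose 2) := by
    intro G
    have hle : G.edgeSet.ncard ≤ n.choose 2 := by
      classical
      rw [← SimpleGraph.coe_edgeFinset, Set.ncard_coe_finset]
      simpa using G.card_edgeFinset_le_card_choose_two
    rw [Measure.real, SimpleGraph.binomialRandom_singleton, ENNReal.toReal_mul,
      ENNReal.toReal_pow, ENNReal.toReal_pow, Nat.card_eq_fintype_card, Fintype.card_fin]
    simp only [ENNReal.coe_toReal, unitInterval.coe_toNNReal, unitInterval.coe_symm_eq]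
    rw [show (1 : ℝ) - 1 / 2 = 1 / 2 by norm_num, ← pow_add, Nat.add_sub_cancel' hle]
  obtain ⟨G₁, G₂⟩ := Y
  rw [← Set.singleton_prod_singleton, randomPair, measureReal_prod_prod, h, h]

/-- Markov's inequality for the uniform distribution on pairs of graphs. -/
lemma randomPair_real_le {E : Set (SimpleGraph (Fin n) × SimpleGraph (Fin n))}
    {f : SimpleGraph (Fin n) → SimpleGraph (Fin n) → ℝ} (hf : ∀ G₁ G₂, 0 ≤ f G₁ G₂) {M B : ℝ}
    (hM : 0 < M) (hE : ∀ Y ∈ E, M ≤ f Y.1 Y.2)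
    (hB : ∑ G₁, ∑ G₂, f G₁ G₂ ≤
      Fintype.card (SimpleGraph (Fin n) × SimpleGraph (Fin n)) * B) :
    (randomPair n).real E ≤ B / M := by
  classical
  set c : ℝ := (1 / 2) ^ (n.choose 2) * (1 / 2) ^ (n.choose 2) with hc
  have hc0 : 0 ≤ c := by positivity
  have hreal : ∀ s : Finset (SimpleGraph (Fin n) × SimpleGraph (Fin n)),
      (randomPair n).real s = #s * c := by
    intro s
    rw [← sum_measureReal_singleton]
    simp only [randomPair_real_singleton, sum_const, nsmul_eq_mul, hc]
  have hone : (Fintype.card (SimpleGraph (Fin n) × SimpleGraph (Fin n)) : ℝ) * c = 1 := by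
    rw [← card_univ, ← hreal, coe_univ, probReal_univ]
  rw [le_div_iff₀ hM]
  calc (randomPair n).real E * M = (∑ Y ∈ E.toFinset, M) * c := by
        rw [← Set.coe_toFinset E, hreal, sum_const, nsmul_eq_mul, Set.coe_toFinset]
        ring
    _ ≤ (∑ Y : SimpleGraph (Fin n) × SimpleGraph (Fin n), f Y.1 Y.2) * c := by
        refine mul_le_mul_of_nonneg_right ?_ hc0
        refine (sum_le_sum fun Y hY => hE Y (Set.mem_toFinset.1 hY)).trans ?_
        exact sum_le_sum_of_subset_of_nonneg (subset_univ _) fun Y _ _ => hf Y.1 Y.2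
    _ ≤ (Fintype.card (SimpleGraph (Fin n) × SimpleGraph (Fin n)) * B) * c := by
        refine mul_le_mul_of_nonneg_right ?_ hc0
        rwa [Fintype.sum_prod_type]
    _ = B := by rw [mul_right_comm, hone, one_mul]

end RandomPair

/-! ### Tail bound for the output size -/

section Tail

variable {n : ℕ} {Ω : Type*} {A : Rules n Ω}

/-- If every extension beyond size `k` costs a factor of at least `exp a`, the probability of
reaching size `m` is at most `exp 1 * k ^ k * exp (- a * (m - k))`. -/
lemma Rules.IsOnline.outputSize_tail (hA : A.IsOnline) (ω : Ω) {k : ℕ} (hk : 0 < k) (hn : 0 < n)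
    {a m : ℝ} (ha : 0 ≤ a) (hkm : k ≤ m)
    (hak : Real.exp a * (2 * (n : ℝ) ^ 2 * (k + 1)) ≤ 2 ^ k) :
    (randomPair n).real {Y | m ≤ (A.outputSize ω Y.1 Y.2 : ℝ)} ≤
      Real.exp 1 * (k : ℝ) ^ k * Real.exp (-(a * (m - k))) := by
  have hL : 0 < Real.exp a := Real.exp_pos a
  -- The case `j = k` suffices: from `k` to `k + i` the right side gains `2 ^ i`, while `k + i + 1 ≤
  -- (k + 1)(i + 1) ≤ (k + 1) * 2 ^ i`.
  have hkL : ∀ j : ℕ, k ≤ j → Real.exp a * (2 * (n : ℝ) ^ 2 * (j + 1)) ≤ 2 ^ j := by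
    intro j hj
    obtain ⟨i, rfl⟩ := Nat.exists_eq_add_of_le hj
    have hi : ((i : ℝ) + 1) ≤ 2 ^ i := by exact_mod_cast Nat.lt_two_pow_self (n := i)
    have hji : ((k + i : ℕ) : ℝ) + 1 ≤ (k + 1) * (i + 1) := by
      push_cast
      nlinarith [(by positivity : (0 : ℝ) ≤ k * i)]
    calc Real.exp a * (2 * (n : ℝ) ^ 2 * ((k + i : ℕ) + 1))
        ≤ Real.exp a * (2 * (n : ℝ) ^ 2 * ((k + 1) * 2 ^ i)) := by
          gcongr
          exact hji.trans (by gcongr)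
      _ = (Real.exp a * (2 * (n : ℝ) ^ 2 * (k + 1))) * 2 ^ i := by ring
      _ ≤ 2 ^ k * 2 ^ i := by gcongr
      _ = 2 ^ (k + i) := by rw [pow_add]
  have hbound := hA.sum_potentialAt_le ω hk hL.le hkL
  have := randomPair_real_le (E := {Y | m ≤ (A.outputSize ω Y.1 Y.2 : ℝ)})
    (f := A.potentialAt ω k (Real.exp a) n) (fun _ _ => potential_nonneg hL.le _ _ _ _)
    (M := Real.exp (a * m)) (Real.exp_pos _) (fun Y hY => ?_) hbound
  · refine this.trans (le_of_eq ?_)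
    rw [mul_assoc, mul_div_assoc, mul_div_assoc]
    congr 2
    rw [← Real.exp_nat_mul, ← Real.exp_sub]
    congr 1
    ring
  · have hm : m ≤ (#(A.state ω Y.1 Y.2 n).S₁ : ℝ) := hY
    have hks : k ≤ #(A.state ω Y.1 Y.2 n).S₁ := by exact_mod_cast hkm.trans hm
    rw [potentialAt, potential, if_neg (not_lt.2 hks), ← Real.exp_nat_mul]
    have hpos : (1 : ℝ) ≤ isoCount Y.1 (A.state ω Y.1 Y.2 n).S₁ Y.2 (A.state ω Y.1 Y.2 n).S₂ := by
      exact_mod_cast isoCount_pos (hA.nonempty_iso ω Y.1 Y.2 le_rfl)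
    calc Real.exp (a * m) ≤ Real.exp (#(A.state ω Y.1 Y.2 n).S₁ * a) := by
          rw [Real.exp_le_exp, mul_comm]
          gcongr
      _ ≤ _ := le_mul_of_one_le_left (Real.exp_pos _).le hpos

end Tail

/-! ### Asymptotic estimates and choice of parameters -/

open Filter in
-- Used with `x = log n` and `k ≤ C * x`: the third bound absorbs the factor `2 * (k + 1)`, the
-- fourth the factor `e * k ^ k`.
lemma eventually_growth_bounds {ε C : ℝ} (hε : 0 < ε) (hC : 0 < C) :
    ∀ᶠ x : ℝ in atTop, 1 ≤ x ∧ 1 ≤ ε / 4 * x ∧ 2 * (C * x + 1) ≤ Real.exp (ε / 4 * x) ∧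
      1 + C * x * Real.log (C * x) ≤ ε ^ 2 / 32 * x ^ 2 := by
  -- The constant makes `C * x * log (C * x)` at most half of `ε² / 32 * x²`; the other half absorbs
  -- the summand `1`.
  have hlog : ∀ᶠ x : ℝ in atTop, Real.log (C * x) ≤ ε ^ 2 / (64 * C ^ 2) * (C * x) := by
    have h := (Real.isLittleO_log_id_atTop.bound
      (by positivity : 0 < ε ^ 2 / (64 * C ^ 2))).and (eventually_ge_atTop 0)
    filter_upwards [(tendsto_id.const_mul_atTop hC).eventually h] with x hx
    obtain ⟨h₁, h₂⟩ := hx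
    simp only [id, Real.norm_eq_abs] at h₁ h₂
    rw [abs_of_nonneg h₂] at h₁
    exact (le_abs_self _).trans h₁
  filter_upwards [hlog, eventually_ge_atTop 1, eventually_ge_atTop (4 / ε),
    eventually_ge_atTop (32 * (2 * C + 2) / ε ^ 2), eventually_ge_atTop (64 / ε ^ 2)]
    with x h₁ h₂ h₃ h₄ h₅
  rw [div_le_iff₀ (by positivity)] at h₃ h₄ h₅
  refine ⟨h₂, by linarith, ?_, ?_⟩
  · have := Real.quadratic_le_exp_of_nonneg (x := ε / 4 * x) (by positivity)
    have h₆ : 32 * (2 * C + 2) * x ≤ x * ε ^ 2 * x := by gcongr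
    have h₇ : 0 < ε / 4 * x := by positivity
    nlinarith
  · have h₆ : C * x * Real.log (C * x) ≤ C * x * (ε ^ 2 / (64 * C ^ 2) * (C * x)) := by gcongr
    have h₇ : C * x * (ε ^ 2 / (64 * C ^ 2) * (C * x)) = ε ^ 2 / 64 * x ^ 2 := by
      field_simp
    nlinarith

end LCIS

theorem theorem1p3 (ε : ℝ) (hε : 0 < ε) :
    ∃ c : ℝ, 0 < c ∧ ∃ N : ℕ, ∀ n : ℕ, N ≤ n →
      ∀ (Ω : Type*) (A : LCIS.Rules n Ω), A ∈ LCIS.Online n Ω → ∀ ω : Ω,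
        (LCIS.randomPair n).real
            {Y | (2 + ε) * Real.logb 2 (n : ℝ) ≤ (A.outputSize ω Y.1 Y.2 : ℝ)}
          ≤ (n : ℝ) ^ (-(c * Real.log (n : ℝ))) := by
  have hlog2 : 0 < Real.log 2 := Real.log_pos one_lt_two
  have hlog2' : Real.log 2 ≤ 1 := by linarith [Real.log_two_lt_d9]
  -- The first summand converts `log₂` into `log`; the `+ 1` pays for rounding `k` up, as `log n ≥
  -- 1`.
  set C : ℝ := (2 + ε / 2) / Real.log 2 + 1 with hC
  have hC0 : 0 < C := by positivity
  obtain ⟨N, hN⟩ := Filter.eventually_atTop.1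
    ((Real.tendsto_log_atTop.comp tendsto_natCast_atTop_atTop).eventually
      (LCIS.eventually_growth_bounds hε hC0))
  -- The gain `L ^ (m - k)` is at least `exp (ε² / 16 * x²)`; half of this exponent is spent on `e *
  -- k ^ k`.
  refine ⟨ε ^ 2 / 32, by positivity, N, fun n hn Ω A hA ω => ?_⟩
  obtain ⟨h₁, h₂, h₃, h₄⟩ := hN n hn
  simp only [Function.comp_apply] at h₁ h₂ h₃ h₄
  set x := Real.log (n : ℝ) with hx
  have hn0 : 0 < n := by
    rcases Nat.eq_zero_or_pos n with rfl | h
    · simp [hx] at h₁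
      linarith
    · exact h
  have hnR : (0 : ℝ) < n := by exact_mod_cast hn0
  have hexp : Real.exp x = n := Real.exp_log hnR
  set y := Real.logb 2 (n : ℝ) with hy
  have hxy : y * Real.log 2 = x := by
    rw [hy, Real.logb, div_mul_cancel₀ _ hlog2.ne']
  have hyx : x ≤ y := by
    have : 0 < y := by
      by_contra h
      nlinarith
    nlinarith
  set k := ⌈(2 + ε / 2) * y⌉₊ with hk
  have hk1 : (2 + ε / 2) * y ≤ k := Nat.le_ceil _
  have hk2 : (k : ℝ) < (2 + ε / 2) * y + 1 := Nat.ceil_lt_add_one (by nlinarith)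
  have hkpos : 0 < (k : ℝ) := lt_of_lt_of_le (by nlinarith) hk1
  have hkC : (k : ℝ) ≤ C * x := by
    have : C * x = (2 + ε / 2) * y + x := by
      rw [hC, ← hxy]
      field_simp
    linarith
  -- Rounding costs `k` at most `ε / 4 * y`, so `m - k` keeps `ε / 4 * y` of the gap `ε / 2 * y`.
  have hεy : 1 ≤ ε / 4 * y := h₂.trans (by gcongr)
  have htail := LCIS.Rules.IsOnline.outputSize_tail hA ω (k := k) (by exact_mod_cast hkpos) hn0
    (a := ε / 4 * x) (m := (2 + ε) * y) (by linarith) (by linarith) (by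
      calc Real.exp (ε / 4 * x) * (2 * (n : ℝ) ^ 2 * (k + 1))
          = Real.exp (ε / 4 * x) * n ^ 2 * (2 * (k + 1)) := by ring
        _ ≤ Real.exp (ε / 4 * x) * n ^ 2 * Real.exp (ε / 4 * x) := by
            gcongr
            linarith
        _ = Real.exp ((2 + ε / 2) * y * Real.log 2) := by
            rw [mul_assoc _ y, hxy, ← hexp, ← Real.exp_nat_mul, ← Real.exp_add, ← Real.exp_add]
            congr 1
            push_cast
            ring
        _ ≤ Real.exp (k * Real.log 2) := by gcongr
        _ = 2 ^ k := by rw [Real.exp_nat_mul, Real.exp_log two_pos])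
  refine htail.trans ?_
  have hkk : (k : ℝ) ^ k = Real.exp (k * Real.log k) := by
    rw [Real.exp_nat_mul, Real.exp_log hkpos]
  have hklog : k * Real.log k ≤ C * x * Real.log (C * x) := by
    have hk1' : (1 : ℝ) ≤ k := by exact_mod_cast hkpos
    have := Real.log_nonneg hk1'
    gcongr
  rw [hkk, Real.rpow_def_of_pos hnR, ← Real.exp_add, ← Real.exp_add, Real.exp_le_exp, ← hx]
  have hgap : ε / 4 * x ≤ (2 + ε) * y - k := by
    have : ε / 4 * x ≤ ε / 4 * y := by gcongr
    linarith
  have := mul_le_mul_of_nonneg_left hgap (by linarith : 0 ≤ ε / 4 * x)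
  nlinarith
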